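/- **Theorem (Variance).** Let $p\ge 2$. For each $N$ let $\mathcal T=\mathcal T^{(N)}$ be a random real symmetric tensor of order $p$ and dimension $N$, i.e. random variables $\mathcal T_{i_1\ldots i_p}$, $1\le i_1,\ldots,i_p\le N$, invariant under permutations of the indices, on a probability space that may depend on $N$. Suppose that the entries $(\mathcal T_{i_1\ldots i_p})_{i_1\le\cdots\le i_p}$ are independent, that every entry is centered, that $\mathbb E[\mathcal T_{i_1\ldots i_p}^2]=\frac1{(p-1)!}$ whenever $i_1,\ldots,i_p$ are distinct, and that all moments are finite uniformly: for every $k\ge 0$, $\sup_{N}\max_{i_1,\ldots,i_p}\mathbb E\big[|\mathcal T^{(N)}_{i_1\ldots i_p}|^k\big]<\infty$. Let $\mathcal W_N=N^{-\frac{p-1}{2}}\,\mathcal T^{(N)}$ (a Wigner tensor of order $p$ and dimension $N$). A combinatorial map $b=(\sigma,\tau)$ on a finite set of halfedges consists of a permutation $\sigma$ and a fixed-point free involution $\tau$ of this set; its vertices $V(b)$ are the cycles of $\sigma$, and its edges $E(b)$ are the cycles $\{x,\tau(x)\}$ of $\tau$, which link the vertices carrying $x$ and $\tau(x)$. It is $p$-regular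 if all cycles of $\sigma$ have length $p$, connected if the resulting graph is connected, and rooted if one halfedge is marked. For a $p$-regular $b$ and a symmetric tensor $\mathcal S$ of order $p$ and dimension $N$ let $$\mathrm{Tr}_b(\mathcal S)=\sum_{a:E(b)\to\{1,\ldots,N\}}\ \prod_{v\in V(b)}\mathcal S_{a_{\delta(v)_1}\ldots a_{\delta(v)_p}},$$ where $\delta(v)_1,\ldots,\delta(v)_p$ are the edges of the successive halfedges $x,\sigma(x),\ldots,\sigma^{p-1}(x)$ of the cycle $v$. For $n\ge 1$ let $\mathcal B_n$ be the set of rooted connected $p$-regular combinatorial maps with $n$ vertices, up to relabelling of the halfedges (preserving the root), and let $$I_n(\mathcal S)=\sum_{b\in\mathcal B_n}\mathrm{Tr}_b(\mathcal S),\qquad I_0(\mathcal S)=N .$$ Then for every $n\ge 0$ the random variable $\frac1N I_n(\mathcal W_N)$ is square-integrable for all $N\geq 1$ and, as $N\to\infty$, $$\mathrm{Var}\Big[\tfrac1N I_n(\mathcal W_N)\Big]=\mathcal O\Big(\frac1{N^2}\Big).$$ -/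

import Mathlib

open MeasureTheory ProbabilityTheory Filter Asymptotics

/-- A real tensor of order `p` and dimension `N` is a function of `p` indices in `Fin N`; it is
symmetric if it is invariant under all permutations of its indices. -/
def SymTensor (p N : ℕ) : Type :=
  {T : (Fin p → Fin N) → ℝ // ∀ (i : Fin p → Fin N) (s : Equiv.Perm (Fin p)), T (i ∘ s) = T i}

/-- The entry `T_{i_1 ... i_p}`. -/
def SymTensor.entry {p N : ℕ} (T : SymTensor p N) (i : Fin p → Fin N) : ℝ := T.1 i

theorem SymTensor.entry_comp {p N : ℕ} (T : SymTensor p N) (i : Fin p → Fin N)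
    (s : Equiv.Perm (Fin p)) : T.entry (i ∘ s) = T.entry i := T.2 i s

/-- The normalized tensor `T / N ^ ((p - 1) / 2)`. -/
noncomputable def SymTensor.normalize {p N : ℕ} (T : SymTensor p N) : SymTensor p N :=
  ⟨fun i => T.entry i / (N : ℝ) ^ (((p : ℝ) - 1) / 2), fun i s => by
    simp only [T.entry_comp]⟩

/-- A combinatorial map on the set `Q` of halfedges: an arbitrary permutation `σ` and an
involution `τ` without fixed points. -/
structure CombMap (Q : Type) where
  σ : Equiv.Perm Q
  τ : Equiv.Perm Q
  τ_invol : ∀ x, τ (τ x) = x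
  τ_ne : ∀ x, τ x ≠ x

namespace CombMap

variable {Q : Type}

/-- The vertices are the cycles of `σ` (fixed points included). -/
def Vertex (b : CombMap Q) : Type := Quotient (Equiv.Perm.SameCycle.setoid b.σ)

/-- The edges are the cycles of `τ`, that is, the pairs `{x, τ x}`. -/
def Edge (b : CombMap Q) : Type := Quotient (Equiv.Perm.SameCycle.setoid b.τ)

/-- The vertex that carries a halfedge. -/
def vertexOf (b : CombMap Q) (x : Q) : b.Vertex :=
  Quotient.mk (Equiv.Perm.SameCycle.setoid b.σ) x

/-- The edge that contains a halfedge. -/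
def edgeOf (b : CombMap Q) (x : Q) : b.Edge :=
  Quotient.mk (Equiv.Perm.SameCycle.setoid b.τ) x

instance (b : CombMap Q) [Finite Q] : Finite b.Vertex := Quotient.finite _

instance (b : CombMap Q) [Finite Q] : Finite b.Edge := Quotient.finite _

noncomputable instance (b : CombMap Q) [Finite Q] : Fintype b.Vertex := Fintype.ofFinite _

noncomputable instance (b : CombMap Q) [Finite Q] : Fintype b.Edge := Fintype.ofFinite _

noncomputable instance (b : CombMap Q) : DecidableEq b.Edge := Classical.decEq _

/-- `b` is `p`-regular: every cycle of `σ` has length `p`. -/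
def IsRegular (b : CombMap Q) (p : ℕ) : Prop := ∀ x, Function.minimalPeriod b.σ x = p

/-- The graph of `b` on the vertices of `b`: the halfedges `x` and `τ x` link the vertices that
carry them. Loops and the multiplicities of edges, which do not matter for connectedness, are
forgotten. -/
def graph (b : CombMap Q) : SimpleGraph b.Vertex :=
  SimpleGraph.fromRel fun v w => ∃ x, b.vertexOf x = v ∧ b.vertexOf (b.τ x) = w

/-- The sequence of the indices carried by the edges around a vertex, read from its halfedge `x`:
`a_{δ(v)_1}, ..., a_{δ(v)_p}`. -/
def indices (b : CombMap Q) (p : ℕ) {N : ℕ} (a : b.Edge → Fin N) (x : Q) : Fin p → Fin N :=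
  fun k => a (b.edgeOf ((b.σ ^ (k : ℕ)) x))

theorem entry_indices_eq (b : CombMap Q) [Finite Q] {p N : ℕ} (hb : b.IsRegular p)
    (T : SymTensor p N) (a : b.Edge → Fin N) {x y : Q} (h : b.σ.SameCycle x y) :
    T.entry (b.indices p a x) = T.entry (b.indices p a y) := by
  obtain ⟨i, rfl⟩ := h.exists_nat_pow_eq
  rcases Nat.eq_zero_or_pos p with rfl | hp
  · exact congrArg _ (Subsingleton.elim _ _)
  · have : NeZero p := ⟨hp.ne'⟩
    rw [← T.entry_comp (b.indices p a x) (Equiv.addRight (Fin.ofNat p i))]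
    congr 1
    funext k
    simp only [indices, Function.comp_apply, Equiv.coe_addRight, Fin.val_add, Fin.val_ofNat,
      Nat.add_mod_mod]
    rw [← Equiv.Perm.mul_apply, ← pow_add]
    congr 2
    have := Function.iterate_mod_minimalPeriod_eq (f := b.σ) (x := x) (n := (k : ℕ) + i)
    rw [hb x] at this
    simpa only [Equiv.Perm.iterate_eq_pow] using this

/-- The entry of `T` at a vertex, `T_{a_{δ(v)_1} ... a_{δ(v)_p}}`; by symmetry of `T` it does not
depend on the halfedge at which one starts to read the edges around the vertex. -/
def vertexEntry (b : CombMap Q) [Finite Q] {p N : ℕ} (hb : b.IsRegular p) (T : SymTensor p N)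
    (a : b.Edge → Fin N) : b.Vertex → ℝ :=
  Quotient.lift (fun x => T.entry (b.indices p a x)) fun _ _ h => b.entry_indices_eq hb T a h

/-- The trace invariant `Tr_b(T) = ∑_a ∏_v T_{a_{δ(v)_1} ... a_{δ(v)_p}}`. -/
noncomputable def trace (b : CombMap Q) [Finite Q] {p N : ℕ} (hb : b.IsRegular p)
    (T : SymTensor p N) : ℝ :=
  ∑ a : b.Edge → Fin N, ∏ v : b.Vertex, b.vertexEntry hb T a v

/-- The trace invariant does not depend on the labels of the halfedges. -/
theorem trace_eq_of_conj (b c : CombMap Q) [Finite Q] {p N : ℕ} (hb : b.IsRegular p)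
    (hc : c.IsRegular p) (T : SymTensor p N) (t : Equiv.Perm Q) (hσ : c.σ = t * b.σ * t⁻¹)
    (hτ : c.τ = t * b.τ * t⁻¹) : b.trace hb T = c.trace hc T := by
  have hpow : ∀ (k : ℕ) (x : Q), (c.σ ^ k) (t x) = t ((b.σ ^ k) x) := by
    intro k x
    rw [hσ, conj_pow]
    simp
  let eV : b.Vertex ≃ c.Vertex := Quotient.congr t fun x y => by
    change b.σ.SameCycle x y ↔ c.σ.SameCycle (t x) (t y)
    rw [hσ, Equiv.Perm.sameCycle_conj]
    simp
  let eE : b.Edge ≃ c.Edge := Quotient.congr t fun x y => by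
    change b.τ.SameCycle x y ↔ c.τ.SameCycle (t x) (t y)
    rw [hτ, Equiv.Perm.sameCycle_conj]
    simp
  refine Fintype.sum_equiv (Equiv.arrowCongr eE (Equiv.refl _)) _ _ fun a => ?_
  refine Fintype.prod_equiv eV _ _ fun v => ?_
  induction v using Quotient.ind with
  | _ x =>
    change T.entry (b.indices p a x) = T.entry (c.indices p _ (t x))
    congr 1
    funext k
    simp only [indices]
    rw [hpow]
    change _ = a (eE.symm (eE (b.edgeOf _)))
    rw [Equiv.symm_apply_apply]

end CombMap

/-- A labelled rooted connected `p`-regular combinatorial map with `n` vertices, on the canonical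
set of `n * p` halfedges. -/
structure RootedMap (p n : ℕ) extends CombMap (Fin (n * p)) where
  root : Fin (n * p)
  regular : toCombMap.IsRegular p
  connected : toCombMap.graph.Connected

namespace RootedMap

variable {p n : ℕ}

instance : Finite (RootedMap p n) :=
  Finite.of_injective (fun b => (b.σ, b.τ, b.root)) fun b c h => by
    obtain ⟨⟨_, _, _, _⟩, _, _, _⟩ := b
    obtain ⟨⟨_, _, _, _⟩, _, _, _⟩ := c
    simp only [Prod.mk.injEq] at h
    obtain ⟨rfl, rfl, rfl⟩ := h
    rfl

/-- Rooted maps are equivalent if they differ by a relabelling of the halfedges that respects the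
roots. -/
instance setoid (p n : ℕ) : Setoid (RootedMap p n) where
  r b c := ∃ t : Equiv.Perm (Fin (n * p)),
    c.σ = t * b.σ * t⁻¹ ∧ c.τ = t * b.τ * t⁻¹ ∧ t b.root = c.root
  iseqv :=
    { refl := fun b => ⟨1, by simp, by simp, by simp⟩
      symm := by
        rintro b c ⟨t, h1, h2, h3⟩
        refine ⟨t⁻¹, ?_, ?_, ?_⟩
        · rw [h1]; group
        · rw [h2]; group
        · rw [← h3]; simp
      trans := by
        rintro b c d ⟨t, h1, h2, h3⟩ ⟨s, k1, k2, k3⟩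
        refine ⟨s * t, ?_, ?_, ?_⟩
        · rw [k1, h1]; group
        · rw [k2, h2]; group
        · rw [← k3, ← h3]; simp }

end RootedMap

/-- The set `B_n^{(p)}` of unlabelled rooted connected `p`-regular combinatorial maps with `n`
vertices. -/
def UnlabelledRootedMap (p n : ℕ) : Type := Quotient (RootedMap.setoid p n)

namespace UnlabelledRootedMap

variable {p n : ℕ}

instance : Finite (UnlabelledRootedMap p n) := Quotient.finite _

noncomputable instance : Fintype (UnlabelledRootedMap p n) := Fintype.ofFinite _

/-- The trace invariant of an unlabelled map: the one of any of its labellings. -/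
noncomputable def trace {N : ℕ} (b : UnlabelledRootedMap p n) (T : SymTensor p N) : ℝ :=
  Quotient.lift (fun b : RootedMap p n => b.toCombMap.trace b.regular T)
    (fun b c h => by
      obtain ⟨t, hσ, hτ, _⟩ := h
      exact CombMap.trace_eq_of_conj b.toCombMap c.toCombMap b.regular c.regular T t hσ hτ) b

end UnlabelledRootedMap

/-- The balanced single trace invariant `I_n(T)`, with `I_0(T) = N`. -/
noncomputable def balancedTrace {p N : ℕ} (n : ℕ) (T : SymTensor p N) : ℝ :=
  if n = 0 then (N : ℝ) else ∑ b : UnlabelledRootedMap p n, b.trace T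

/-- The random symmetric tensor `T`, before normalization, of a Wigner tensor. Independence up to
symmetries is the independence of the entries whose indices are in nondecreasing order. The
variance is prescribed only for the entries with distinct indices. -/
structure IsWignerEntries {p N : ℕ} {Ω : Type*} [MeasurableSpace Ω] (μ : Measure Ω)
    (T : Ω → SymTensor p N) : Prop where
  measurable : ∀ i, Measurable fun ω => (T ω).entry i
  indep : iIndepFun
    (fun (i : {i : Fin p → Fin N // Monotone i}) (ω : Ω) => (T ω).entry i.1) μ
  finite_moments : ∀ i (k : ℕ), Integrable (fun ω => |(T ω).entry i| ^ k) μ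
  centered : ∀ i, ∫ ω, (T ω).entry i ∂μ = 0
  second_moment : ∀ i, Function.Injective i →
    ∫ ω, (T ω).entry i ^ 2 ∂μ = 1 / ((p - 1).factorial : ℝ)

/-! There are finitely many maps, so one connected map with `m` vertices suffices. Expanding its
trace over index assignments, the variance is a sum over pairs of assignments of covariances of
monomials in independent centered entries, one for each sorted index tuple (a class). Such a
covariance is bounded by moments, and vanishes unless the two monomials share a class and no class
occurs exactly once in their product (`covariance_prod_eq_zero`). The heart is `card_colors_le`: a
surviving pair uses at most `m * (p - 1)` distinct indices. Hence `O(N ^ (m * (p - 1)))` pairs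
survive, the normalization cancels this power exactly, and the prefactor `1 / N` leaves `N ^ (-2)`.

Connectedness alone gives one index too many: the `2 * m` occurrences make at most `m` classes, the
first bringing at most `p` indices and each further one at most `p - 1`. The excess is removed by
looking at the classes of odd multiplicity in the first monomial. If there are none, a shared class
occurs at least three times in all, so there are fewer than `m` classes. Otherwise, each edge places
its index twice, so by parity every index on the odd classes occurs at least twice among them; they
carry at most `p / 2 ≤ p - 1` indices per class, and growth starts from them. -/

/-! ### Counting indices on connected hypergraphs -/

/-- Growing a connected hypergraph from a nonempty set of hyperedges: each further hyperedge brings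
at most `q` new points if hyperedges have at most `q + 1` points. -/
theorem card_biUnion_add_le_of_connected {J C : Type*} [DecidableEq J] [DecidableEq C]
    (col : J → Finset C) (q : ℕ) (hcol : ∀ j, (col j).card ≤ q + 1) (H : Finset J)
    (hconn : ∀ S ⊆ H, S.Nonempty → S ≠ H →
      ∃ h ∈ H, h ∉ S ∧ ¬ Disjoint (col h) (S.biUnion col))
    (S : Finset J) (hS : S ⊆ H) (hne : S.Nonempty) :
    (H.biUnion col).card + S.card * q ≤ (S.biUnion col).card + H.card * q := by
  induction hd : (H \ S).card generalizing S with
  | zero =>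
    have : S = H := hS.antisymm (Finset.sdiff_eq_empty_iff_subset.mp (Finset.card_eq_zero.mp hd))
    rw [this]
  | succ d ih =>
    have hSH : S ≠ H := by rintro rfl; simp at hd
    obtain ⟨h, hH, hnS, hdis⟩ := hconn S hS hne hSH
    have hsub : insert h S ⊆ H := Finset.insert_subset hH hS
    have hcard : (H \ insert h S).card = d := by
      have h1 := Finset.card_sdiff_add_card_eq_card hS
      have h2 := Finset.card_sdiff_add_card_eq_card hsub
      rw [Finset.card_insert_of_notMem hnS] at h2
      omega
    have key := ih (insert h S) hsub (Finset.insert_nonempty _ _) hcard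
    rw [Finset.card_insert_of_notMem hnS, Finset.biUnion_insert] at key
    have hint : 0 < (col h ∩ S.biUnion col).card := by
      rw [Finset.card_pos]
      exact Finset.not_disjoint_iff_nonempty_inter.mp hdis
    have hun := Finset.card_union_add_card_inter (col h) (S.biUnion col)
    have := hcol h
    rw [add_mul, one_mul] at key
    omega

/-- The number of occurrences of `c` in the tuple `i`. -/
def tupleCount {p : ℕ} {C : Type*} [DecidableEq C] (i : Fin p → C) (c : C) : ℕ :=
  (Finset.univ.filter fun k => i k = c).card

theorem tupleCount_comp_perm {p : ℕ} {C : Type*} [DecidableEq C] (i : Fin p → C)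
    (s : Equiv.Perm (Fin p)) (c : C) : tupleCount (i ∘ s) c = tupleCount i c :=
  Finset.card_equiv s (by simp)

theorem one_le_tupleCount {p : ℕ} {C : Type*} [DecidableEq C] {i : Fin p → C} {c : C}
    (hc : c ∈ Finset.univ.image i) : 1 ≤ tupleCount i c := by
  obtain ⟨k, -, hk⟩ := Finset.mem_image.mp hc
  exact Finset.card_pos.mpr ⟨k, by simpa using hk⟩

theorem sum_tupleCount_le {p : ℕ} {C : Type*} [DecidableEq C] (i : Fin p → C) (s : Finset C) :
    ∑ c ∈ s, tupleCount i c ≤ p := by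
  simp only [tupleCount]
  rw [Finset.sum_card_fiberwise_eq_card_filter]
  exact (Finset.card_filter_le _ _).trans (by simp)

/-- The number of elements that a map sends to `j`. -/
def fiberCount {V J : Type*} [Fintype V] [DecidableEq J] (k : V → J) (j : J) : ℕ :=
  (Finset.univ.filter fun v => k v = j).card

theorem fiberCount_pos {V J : Type*} [Fintype V] [DecidableEq J] (k : V → J) (v : V) :
    0 < fiberCount k (k v) :=
  Finset.card_pos.mpr ⟨v, by simp⟩

theorem fiberCount_eq_zero {V J : Type*} [Fintype V] [DecidableEq J] {k : V → J} {j : J}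
    (h : ∀ v, k v ≠ j) : fiberCount k j = 0 :=
  Finset.card_eq_zero.mpr (by simpa [Finset.filter_eq_empty_iff] using h)

theorem sum_fiberCount {V J : Type*} [Fintype V] [DecidableEq J] (k : V → J) (H : Finset J)
    (hH : ∀ v, k v ∈ H) : ∑ j ∈ H, fiberCount k j = Fintype.card V := by
  simp only [fiberCount]
  rw [← Finset.card_eq_sum_card_fiberwise (fun v _ => hH v), Finset.card_univ]

theorem sum_comp_eq_sum_fiberCount_mul {V J : Type*} [Fintype V] [DecidableEq J] (k : V → J)
    (H : Finset J) (hH : ∀ v, k v ∈ H) (f : J → ℕ) :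
    ∑ v, f (k v) = ∑ j ∈ H, fiberCount k j * f j := by
  rw [← Finset.sum_fiberwise_of_maps_to' (fun v _ => hH v)]
  simp [fiberCount]

/-- The bound on the number of colours carried by two families of `p`-tuples, indexed by `V`, whose
tuples form a connected hypergraph, are all repeated, and are not all private to one family, when
every colour occurs an even number of times in the first family. -/
theorem card_colors_le {J C V : Type*} [DecidableEq J] [DecidableEq C] [Fintype V] {p : ℕ}
    (hp : 2 ≤ p) (t : J → Fin p → C) (k k' : V → J) (H : Finset J)
    (hk : ∀ v, k v ∈ H) (hk' : ∀ v, k' v ∈ H)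
    (hconn : ∀ S ⊆ H, S.Nonempty → S ≠ H → ∃ h ∈ H, h ∉ S ∧
      ¬ Disjoint (Finset.univ.image (t h)) (S.biUnion fun j => Finset.univ.image (t j)))
    (hmult : ∀ j ∈ H, 2 ≤ fiberCount k j + fiberCount k' j)
    (hshared : ∃ v v', k v = k' v')
    (heven : ∀ c, Even (∑ v, tupleCount (t (k v)) c)) :
    (H.biUnion fun j => Finset.univ.image (t j)).card ≤ Fintype.card V * (p - 1) := by
  obtain ⟨q, rfl⟩ : ∃ q, p = q + 2 := ⟨p - 2, by omega⟩
  rw [show q + 2 - 1 = q + 1 by omega]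
  have hcol : ∀ j, (Finset.univ.image (t j)).card ≤ (q + 1) + 1 := fun j =>
    Finset.card_image_le.trans (by simp)
  have grow := card_biUnion_add_le_of_connected
    (fun j => Finset.univ.image (t j)) (q + 1) hcol H hconn
  have hsum : ∑ j ∈ H, (fiberCount k j + fiberCount k' j) = 2 * Fintype.card V := by
    rw [Finset.sum_add_distrib, sum_fiberCount k H hk, sum_fiberCount k' H hk', two_mul]
  have hK : H.card ≤ Fintype.card V := by
    have := Finset.card_nsmul_le_sum H _ 2 hmult
    rw [hsum, smul_eq_mul] at this
    omega
  set S := H.filter fun j => Odd (fiberCount k j) with hS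
  rcases S.eq_empty_or_nonempty with hempty | hne
  -- No odd class: the shared class occurs at least twice in `k` and once in `k'`, so `H.card <
  -- Fintype.card V`, which pays for the extra colour of the initial hyperedge.
  · obtain ⟨v, v', hv⟩ := hshared
    have h0 : k v ∈ H := hk v
    have heven0 : Even (fiberCount k (k v)) := by
      by_contra hodd
      rw [Nat.not_even_iff_odd] at hodd
      exact Finset.notMem_empty (k v) (hempty ▸ Finset.mem_filter.mpr ⟨h0, hodd⟩)
    have h1 := fiberCount_pos k v
    have h2 : 0 < fiberCount k' (k v) := hv ▸ fiberCount_pos k' v'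
    have hlt : ∑ j ∈ H, 2 < ∑ j ∈ H, (fiberCount k j + fiberCount k' j) :=
      Finset.sum_lt_sum hmult ⟨k v, h0, by obtain ⟨r, hr⟩ := heven0; omega⟩
    rw [hsum, Finset.sum_const, smul_eq_mul] at hlt
    have hg := grow {k v} (by simpa using h0) (Finset.singleton_nonempty _)
    rw [Finset.singleton_biUnion, Finset.card_singleton, one_mul] at hg
    have h3 := hcol (k v)
    have h4 : (H.card + 1) * (q + 1) ≤ Fintype.card V * (q + 1) :=
      Nat.mul_le_mul_right _ (by omega)
    rw [add_mul, one_mul] at h4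
    omega
  · have hg := grow S (Finset.filter_subset _ _) hne
    have hSc : 2 * (S.biUnion fun j => Finset.univ.image (t j)).card ≤ S.card * (q + 2) := by
      have hcount : ∀ c ∈ S.biUnion fun j => Finset.univ.image (t j),
          2 ≤ ∑ j ∈ S, tupleCount (t j) c := by
        intro c hc
        have he : Even (∑ j ∈ S, tupleCount (t j) c) := by
          have h1 := heven c
          rw [sum_comp_eq_sum_fiberCount_mul k H hk fun j => tupleCount (t j) c] at h1
          rw [← Finset.sum_filter_add_sum_filter_not H fun j => Odd (fiberCount k j)] at h1
          have h2 : Even (∑ j ∈ H with ¬ Odd (fiberCount k j),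
              fiberCount k j * tupleCount (t j) c) := by
            refine Finset.even_sum _ fun j hj => ?_
            rw [Finset.mem_filter, Nat.not_odd_iff_even] at hj
            exact hj.2.mul_right _
          have h3 := (Nat.even_add.mp h1).mpr h2
          -- Modulo 2, the odd coefficients on `S` can be replaced by 1.
          have h4 : Even (∑ j ∈ S, (fiberCount k j + 1) * tupleCount (t j) c) := by
            refine Finset.even_sum _ fun j hj => ?_
            rw [hS, Finset.mem_filter] at hj
            exact hj.2.add_one.mul_right _
          simp only [add_mul, one_mul, Finset.sum_add_distrib] at h4
          exact (Nat.even_add.mp h4).mp h3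
        obtain ⟨j, hj, hcj⟩ := Finset.mem_biUnion.mp hc
        have h1 : 1 ≤ ∑ j ∈ S, tupleCount (t j) c :=
          (one_le_tupleCount hcj).trans
            (Finset.single_le_sum (f := fun j => tupleCount (t j) c) (by simp) hj)
        obtain ⟨r, hr⟩ := he
        omega
      have h1 := Finset.card_nsmul_le_sum _ _ 2 hcount
      rw [Finset.sum_comm, smul_eq_mul] at h1
      have h2 := Finset.sum_le_card_nsmul S _ (q + 2)
        fun j _ => sum_tupleCount_le (t j) (S.biUnion fun j => Finset.univ.image (t j))
      rw [smul_eq_mul] at h2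
      omega
    have h1 : H.card * (q + 1) ≤ Fintype.card V * (q + 1) := Nat.mul_le_mul_right _ hK
    -- This is `p ≤ 2 * (p - 1)`: starting from `S` costs no more than `p - 1` colours per class.
    have h2 : S.card * (q + 2) ≤ 2 * (S.card * (q + 1)) := by nlinarith
    omega

/-- There are at most `r ^ e * N ^ r` functions from a set of `e` elements to a set of `N` elements
that take at most `r` values. -/
theorem card_filter_card_image_le {E C : Type*} [Fintype E] [Fintype C] [DecidableEq E]
    [DecidableEq C] [Nonempty E] (r : ℕ) :
    (Finset.univ.filter fun f : E → C => (Finset.univ.image f).card ≤ r).card ≤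
      r ^ Fintype.card E * Fintype.card C ^ r := by
  have hsub : (Finset.univ.filter fun f : E → C => (Finset.univ.image f).card ≤ r) ⊆
      Finset.univ.image fun x : (E → Fin r) × (Fin r → C) => x.2 ∘ x.1 := by
    intro f hf
    rw [Finset.mem_filter] at hf
    rw [Finset.mem_image]
    -- Factor `f` through `Fin r` by numbering its values; the labels outside the range of `g` are
    -- never read.
    obtain ⟨g⟩ : Nonempty ((Finset.univ.image f) ↪ Fin r) :=
      Function.Embedding.nonempty_of_card_le (by rw [Fintype.card_coe, Fintype.card_fin]; exact hf.2)
    have : Nonempty (Finset.univ.image f) := ⟨⟨f (Classical.arbitrary E), by simp⟩⟩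
    refine ⟨(fun e => g ⟨f e, by simp⟩, fun x => (Function.invFun g x).1),
      Finset.mem_univ _, ?_⟩
    funext e
    simp only [Function.comp_apply]
    rw [Function.leftInverse_invFun g.injective]
  refine (Finset.card_le_card hsub).trans (Finset.card_image_le.trans ?_)
  simp

/-! ### Moments and covariances of monomials -/

/-- The largest factor dominates all the others. This reduces mixed moments to moments of single
entries without Hölder's inequality. -/
theorem Finset.prod_abs_le_sum_abs_pow {V : Type*} [Fintype V] [Nonempty V] (x : V → ℝ) :
    |∏ v, x v| ≤ ∑ v, |x v| ^ Fintype.card V := by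
  obtain ⟨w, -, hw⟩ := Finset.exists_max_image Finset.univ (fun v => |x v|) Finset.univ_nonempty
  calc |∏ v, x v| = ∏ v, |x v| := Finset.abs_prod _ _
    _ ≤ ∏ _v : V, |x w| := Finset.prod_le_prod (fun v _ => abs_nonneg _) hw
    _ = |x w| ^ Fintype.card V := by simp
    _ ≤ _ := Finset.single_le_sum (f := fun v => |x v| ^ Fintype.card V)
      (fun v _ => by positivity) (Finset.mem_univ w)

/-- Makes the bounds for one monomial apply to a product of two. -/
theorem prod_mul_prod_eq_prod_sumElim {Ω J V : Type*} [Fintype V] (X : J → Ω → ℝ) (k k' : V → J) (ω : Ω) :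
    (∏ v, X (k v) ω) * ∏ v, X (k' v) ω = ∏ v : V ⊕ V, X (Sum.elim k k' v) ω := by
  simp

theorem prod_comp_eq_prod_pow_fiberCount {Ω J V : Type*} [Fintype V] [Fintype J]
    [DecidableEq J] (X : J → Ω → ℝ) (k : V → J) (ω : Ω) :
    ∏ v, X (k v) ω = ∏ j, X j ω ^ fiberCount k j := by
  rw [← Finset.prod_fiberwise Finset.univ k]
  refine Finset.prod_congr rfl fun j _ => ?_
  rw [fiberCount, ← Finset.prod_const]
  refine Finset.prod_congr rfl fun v hv => ?_
  rw [(Finset.mem_filter.mp hv).2]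

section Moments

variable {Ω : Type*} [MeasurableSpace Ω] {μ : Measure Ω} {J : Type*} {X : J → Ω → ℝ}

theorem integrable_prod_of_moments {V : Type*} [Fintype V] [Nonempty V]
    (hX : ∀ j, Measurable (X j)) (hint : ∀ j (k : ℕ), Integrable (fun ω => |X j ω| ^ k) μ)
    (k : V → J) : Integrable (fun ω => ∏ v, X (k v) ω) μ := by
  refine Integrable.mono' (integrable_finsetSum Finset.univ
    fun v _ => hint (k v) (Fintype.card V)) ?_ (Eventually.of_forall fun ω => ?_)
  · exact (Finset.measurable_fun_prod _ fun v _ => hX (k v)).aestronglyMeasurable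
  · rw [Real.norm_eq_abs]
    exact Finset.prod_abs_le_sum_abs_pow fun v => X (k v) ω

theorem abs_integral_prod_le_of_moments {V : Type*} [Fintype V] [Nonempty V]
    (hint : ∀ j (k : ℕ), Integrable (fun ω => |X j ω| ^ k) μ)
    {B : ℝ} (hB : ∀ j, ∫ ω, |X j ω| ^ Fintype.card V ∂μ ≤ B) (k : V → J) :
    |∫ ω, ∏ v, X (k v) ω ∂μ| ≤ Fintype.card V * B := by
  calc |∫ ω, ∏ v, X (k v) ω ∂μ| ≤ ∫ ω, ∑ v, |X (k v) ω| ^ Fintype.card V ∂μ := by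
        rw [← Real.norm_eq_abs]
        refine norm_integral_le_of_norm_le (integrable_finsetSum Finset.univ
          fun v _ => hint (k v) (Fintype.card V)) (Eventually.of_forall fun ω => ?_)
        rw [Real.norm_eq_abs]
        exact Finset.prod_abs_le_sum_abs_pow fun v => X (k v) ω
    _ = ∑ v, ∫ ω, |X (k v) ω| ^ Fintype.card V ∂μ :=
        integral_finsetSum _ fun v _ => hint (k v) _
    _ ≤ ∑ _v : V, B := Finset.sum_le_sum fun v _ => hB (k v)
    _ = _ := by simp

theorem memLp_two_prod_of_moments {V : Type*} [Fintype V] [Nonempty V]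
    (hX : ∀ j, Measurable (X j)) (hint : ∀ j (k : ℕ), Integrable (fun ω => |X j ω| ^ k) μ)
    (k : V → J) : MemLp (fun ω => ∏ v, X (k v) ω) 2 μ := by
  rw [memLp_two_iff_integrable_sq
    (Finset.measurable_fun_prod _ fun v _ => hX (k v)).aestronglyMeasurable]
  simp only [sq, prod_mul_prod_eq_prod_sumElim]
  exact integrable_prod_of_moments hX hint _

theorem abs_covariance_prod_le_of_moments [IsProbabilityMeasure μ] {V : Type*} [Fintype V]
    [Nonempty V] (hX : ∀ j, Measurable (X j))
    (hint : ∀ j (k : ℕ), Integrable (fun ω => |X j ω| ^ k) μ)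
    {B B' : ℝ} (hB : ∀ j, ∫ ω, |X j ω| ^ Fintype.card V ∂μ ≤ B)
    (hB' : ∀ j, ∫ ω, |X j ω| ^ Fintype.card (V ⊕ V) ∂μ ≤ B') (k k' : V → J) :
    |covariance (fun ω => ∏ v, X (k v) ω) (fun ω => ∏ v, X (k' v) ω) μ| ≤
      Fintype.card (V ⊕ V) * B' + (Fintype.card V * B) ^ 2 := by
  rw [covariance_eq_sub (memLp_two_prod_of_moments hX hint k)
    (memLp_two_prod_of_moments hX hint k')]
  simp only [Pi.mul_apply, prod_mul_prod_eq_prod_sumElim]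
  refine (abs_sub _ _).trans (add_le_add (abs_integral_prod_le_of_moments hint hB' _) ?_)
  rw [abs_mul, sq]
  have h := abs_integral_prod_le_of_moments hint hB
  exact mul_le_mul (h k) (h k') (abs_nonneg _) ((abs_nonneg _).trans (h k))

variable [Fintype J]

theorem ProbabilityTheory.iIndepFun.integral_prod_pow [IsProbabilityMeasure μ]
    (hindep : iIndepFun X μ) (hX : ∀ j, Measurable (X j)) (m : J → ℕ) :
    ∫ ω, ∏ j, X j ω ^ m j ∂μ = ∏ j, ∫ ω, X j ω ^ m j ∂μ :=
  hindep.integral_fun_prod_comp (f := fun j x => x ^ m j) (fun j => (hX j).aemeasurable)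
    fun _ => (measurable_id.pow_const _).aestronglyMeasurable

/-- Two monomials in independent centered variables are uncorrelated if they share no variable or
if some variable occurs exactly once in their product. -/
theorem covariance_prod_eq_zero [IsProbabilityMeasure μ] {V : Type*} [Fintype V] [Nonempty V]
    [DecidableEq J] (hindep : iIndepFun X μ) (hX : ∀ j, Measurable (X j))
    (hint : ∀ j (k : ℕ), Integrable (fun ω => |X j ω| ^ k) μ) (hcent : ∀ j, ∫ ω, X j ω ∂μ = 0)
    (k k' : V → J)
    (h : (∀ v v', k v ≠ k' v') ∨ ∃ j, fiberCount k j + fiberCount k' j = 1) :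
    covariance (fun ω => ∏ v, X (k v) ω) (fun ω => ∏ v, X (k' v) ω) μ = 0 := by
  rw [covariance_eq_sub (memLp_two_prod_of_moments hX hint k)
    (memLp_two_prod_of_moments hX hint k')]
  simp only [Pi.mul_apply, prod_comp_eq_prod_pow_fiberCount, ← Finset.prod_mul_distrib, ← pow_add,
    hindep.integral_prod_pow hX]
  rw [sub_eq_zero]
  -- Without a shared variable, one of the two exponents is zero at each `j`, so the expectations
  -- factor. With a variable of total exponent one, its zero mean kills both terms.
  rcases h with h | ⟨j, hj⟩
  · refine Finset.prod_congr rfl fun j _ => ?_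
    by_cases hj : ∃ v, k v = j
    · obtain ⟨v, rfl⟩ := hj
      simp [fiberCount_eq_zero fun v' => (h v v').symm]
    · push Not at hj
      simp [fiberCount_eq_zero hj]
  · rw [Finset.prod_eq_zero (Finset.mem_univ j) (by simp [hj, hcent])]
    refine (Finset.prod_eq_zero (Finset.mem_univ j) ?_).symm
    have h1 : fiberCount k j = 1 ∨ fiberCount k' j = 1 := by omega
    rcases h1 with h1 | h1 <;> simp [h1, hcent]

end Moments

/-- If a family of random variables has uniformly bounded covariances, its sum has variance at most
this bound times the number of correlated pairs. -/
theorem variance_sum_le_card_mul {Ω A : Type*} [MeasurableSpace Ω] {μ : Measure Ω}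
    [IsProbabilityMeasure μ] [Fintype A] (Y : A → Ω → ℝ) (hY : ∀ a, MemLp (Y a) 2 μ) {D : ℝ}
    (hD : ∀ a a', |covariance (Y a) (Y a') μ| ≤ D) (G : Finset (A × A))
    (hG : ∀ a a', (a, a') ∉ G → covariance (Y a) (Y a') μ = 0) :
    variance (fun ω => ∑ a, Y a ω) μ ≤ G.card * D := by
  rw [variance_fun_sum hY, ← Fintype.sum_prod_type' fun a a' => covariance (Y a) (Y a') μ,
    ← Finset.sum_subset (Finset.subset_univ G) fun x _ hx => hG x.1 x.2 hx, ← nsmul_eq_mul]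
  exact Finset.sum_le_card_nsmul _ _ _ fun x _ => (le_abs_self _).trans (hD x.1 x.2)

/-- The parallelogram identity; the trace invariants of different maps may well be correlated. -/
theorem variance_add_le_two_mul {Ω : Type*} [MeasurableSpace Ω] {μ : Measure Ω}
    [IsProbabilityMeasure μ] {X Y : Ω → ℝ} (hX : MemLp X 2 μ) (hY : MemLp Y 2 μ) :
    variance (fun ω => X ω + Y ω) μ ≤ 2 * variance X μ + 2 * variance Y μ := by
  have h1 := variance_fun_add hX hY
  have h2 := variance_fun_sub hX hY
  have h3 := variance_nonneg (fun ω => X ω - Y ω) μ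
  linarith

/-! ### From combinatorial maps to hypergraphs of entry classes -/

/-- The nondecreasing rearrangement of a tuple. -/
def sortedTuple {p N : ℕ} (i : Fin p → Fin N) : {i : Fin p → Fin N // Monotone i} :=
  ⟨i ∘ Tuple.sort i, Tuple.monotone_sort i⟩

theorem SymTensor.entry_sortedTuple {p N : ℕ} (T : SymTensor p N) (i : Fin p → Fin N) :
    T.entry (sortedTuple i).1 = T.entry i := T.entry_comp i _

theorem image_sortedTuple {p N : ℕ} (i : Fin p → Fin N) :
    Finset.univ.image (sortedTuple i).1 = Finset.univ.image i := by
  ext c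
  simp only [sortedTuple, Finset.mem_image, Finset.mem_univ, true_and, Function.comp_apply]
  exact ((Tuple.sort i).surjective.exists (p := fun k => i k = c)).symm

namespace CombMap

variable {Q : Type} (b : CombMap Q) {p N : ℕ}

theorem edgeOf_τ (x : Q) : b.edgeOf (b.τ x) = b.edgeOf x :=
  Quotient.sound (s := Equiv.Perm.SameCycle.setoid b.τ)
    (show b.τ.SameCycle (b.τ x) x from Equiv.Perm.sameCycle_apply_left.mpr (.refl _ _))

theorem vertexOf_out (v : b.Vertex) : b.vertexOf v.out = v := Quotient.out_eq _

theorem sameCycle_out (x : Q) : b.σ.SameCycle (b.vertexOf x).out x :=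
  Quotient.exact (s := Equiv.Perm.SameCycle.setoid b.σ) (b.vertexOf_out (b.vertexOf x))

theorem exists_pow_out_eq [Finite Q] (hb : b.IsRegular p) (hp : 0 < p) (x : Q) :
    ∃ k : Fin p, (b.σ ^ (k : ℕ)) (b.vertexOf x).out = x := by
  obtain ⟨i, hi⟩ := (b.sameCycle_out x).exists_nat_pow_eq
  refine ⟨⟨i % p, Nat.mod_lt _ hp⟩, ?_⟩
  have h := Function.iterate_mod_minimalPeriod_eq (f := b.σ) (x := (b.vertexOf x).out) (n := i)
  rw [hb] at h
  simpa only [Equiv.Perm.iterate_eq_pow, hi] using h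

theorem vertexOf_pow (x : Q) (k : ℕ) : b.vertexOf ((b.σ ^ k) x) = b.vertexOf x :=
  Quotient.sound (s := Equiv.Perm.SameCycle.setoid b.σ)
    (show b.σ.SameCycle ((b.σ ^ k) x) x from Equiv.Perm.sameCycle_pow_left.mpr (.refl _ _))

/-- In a `p`-regular map the halfedges are enumerated by the vertices and `p` positions. -/
theorem bijective_pow_out [Finite Q] (hb : b.IsRegular p) (hp : 0 < p) :
    Function.Bijective fun x : b.Vertex × Fin p => (b.σ ^ (x.2 : ℕ)) x.1.out := by
  refine ⟨?_, fun x => ?_⟩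
  · rintro ⟨v, k⟩ ⟨w, l⟩ h
    have h : (b.σ ^ (k : ℕ)) v.out = (b.σ ^ (l : ℕ)) w.out := h
    have hvw : v = w := by
      have := congrArg b.vertexOf h
      simpa only [vertexOf_pow, vertexOf_out] using this
    subst hvw
    have := Function.iterate_injOn_Iio_minimalPeriod (f := b.σ) (x := v.out)
      (show (k : ℕ) ∈ Set.Iio _ by rw [hb]; exact k.2)
      (show (l : ℕ) ∈ Set.Iio _ by rw [hb]; exact l.2)
      (by simpa only [Equiv.Perm.iterate_eq_pow] using h)
    rw [Fin.ext this]
  · obtain ⟨k, hk⟩ := b.exists_pow_out_eq hb hp x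
    exact ⟨(b.vertexOf x, k), hk⟩

/-- The fixed-point free involution `τ` preserves edges, hence pairs off the halfedges of a given
colour. -/
theorem even_card_halfedges [Fintype Q] (f : b.Edge → Fin N) (c : Fin N) :
    Even (Finset.univ.filter fun x : Q => f (b.edgeOf x) = c).card := by
  rw [← ZMod.natCast_eq_zero_iff_even, Finset.card_eq_sum_ones, Nat.cast_sum]
  refine Finset.sum_involution (fun x _ => b.τ x) (fun _ _ => by decide)
    (fun x _ _ => b.τ_ne x) (fun x hx => ?_) (fun x _ => b.τ_invol x)
  simpa [edgeOf_τ] using hx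

/-- The entry class at a vertex: its sorted tuple of indices. -/
noncomputable def vertexTuple (p : ℕ) (a : b.Edge → Fin N) (v : b.Vertex) :
    {i : Fin p → Fin N // Monotone i} :=
  sortedTuple (b.indices p a v.out)

theorem vertexEntry_eq [Finite Q] (hb : b.IsRegular p) (T : SymTensor p N) (a : b.Edge → Fin N)
    (v : b.Vertex) : b.vertexEntry hb T a v = T.entry (b.vertexTuple p a v).1 := by
  rw [vertexTuple, T.entry_sortedTuple]
  conv_lhs => rw [← b.vertexOf_out v]
  rfl

/-- The parity input of `card_colors_le`: counting a colour over vertices and positions amounts to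
counting halfedges. -/
theorem even_sum_tupleCount [Finite Q] (hb : b.IsRegular p) (hp : 0 < p) (a : b.Edge → Fin N)
    (c : Fin N) : Even (∑ v, tupleCount (b.vertexTuple p a v).1 c) := by
  have := Fintype.ofFinite Q
  convert b.even_card_halfedges a c using 1
  have h1 : ∀ v, tupleCount (b.vertexTuple p a v).1 c =
      ∑ k : Fin p, if a (b.edgeOf ((b.σ ^ (k : ℕ)) v.out)) = c then 1 else 0 := by
    intro v
    rw [vertexTuple, sortedTuple, tupleCount_comp_perm, tupleCount, Finset.card_filter]
    rfl
  simp only [h1]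
  rw [Finset.card_filter, ← Fintype.sum_prod_type' fun (v : b.Vertex) (k : Fin p) =>
    if a (b.edgeOf ((b.σ ^ (k : ℕ)) v.out)) = c then 1 else 0]
  exact Fintype.sum_bijective _ (b.bijective_pow_out hb hp) _ _ fun _ => rfl

theorem mem_image_vertexTuple [Finite Q] (hb : b.IsRegular p) (hp : 0 < p) (a : b.Edge → Fin N)
    (x : Q) : a (b.edgeOf x) ∈ Finset.univ.image (b.vertexTuple p a (b.vertexOf x)).1 := by
  rw [vertexTuple, image_sortedTuple]
  obtain ⟨k, hk⟩ := b.exists_pow_out_eq hb hp x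
  refine Finset.mem_image.mpr ⟨k, Finset.mem_univ _, ?_⟩
  rw [indices, hk]

theorem not_disjoint_of_adj [Finite Q] (hb : b.IsRegular p) (hp : 0 < p) (a : b.Edge → Fin N)
    {v w : b.Vertex} (h : b.graph.Adj v w) :
    ¬ Disjoint (Finset.univ.image (b.vertexTuple p a v).1)
      (Finset.univ.image (b.vertexTuple p a w).1) := by
  obtain ⟨-, ⟨x, rfl, rfl⟩ | ⟨x, rfl, rfl⟩⟩ := (SimpleGraph.fromRel_adj _ _ _).mp h
  all_goals
    have h1 := b.mem_image_vertexTuple hb hp a x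
    have h2 := b.mem_image_vertexTuple hb hp a (b.τ x)
    rw [edgeOf_τ] at h2
  · exact Finset.not_disjoint_iff.mpr ⟨_, h1, h2⟩
  · exact Finset.not_disjoint_iff.mpr ⟨_, h2, h1⟩

/-- A set of entry classes that no other class of a connected map touches contains all the classes
of the map as soon as it contains one of them. -/
theorem vertexTuple_mem_of_mem [Finite Q] (hb : b.IsRegular p) (hp : 0 < p)
    (hconn : b.graph.Connected) (a : b.Edge → Fin N)
    (S : Finset {i : Fin p → Fin N // Monotone i})
    (hS : ∀ v, b.vertexTuple p a v ∉ S → Disjoint (Finset.univ.image (b.vertexTuple p a v).1)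
      (S.biUnion fun j => Finset.univ.image j.1))
    {v : b.Vertex} (hv : b.vertexTuple p a v ∈ S) (w : b.Vertex) : b.vertexTuple p a w ∈ S := by
  obtain ⟨q⟩ := hconn.preconnected v w
  induction q with
  | nil => exact hv
  | cons hadj _ ih =>
    refine ih ?_
    by_contra hnot
    refine b.not_disjoint_of_adj hb hp a hadj.symm ((hS _ hnot).mono_right ?_)
    exact Finset.subset_biUnion_of_mem (fun j : {i : Fin p → Fin N // Monotone i} =>
      Finset.univ.image j.1) hv

/-- The pairs of index assignments whose monomials may be correlated carry at most `(p - 1) |V|`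
different indices. -/
theorem card_image_sumElim_le [Finite Q] (hb : b.IsRegular p) (hp : 2 ≤ p)
    (hconn : b.graph.Connected) (a a' : b.Edge → Fin N)
    (hshared : ∃ v v', b.vertexTuple p a v = b.vertexTuple p a' v')
    (hmult : ∀ j, fiberCount (b.vertexTuple p a) j + fiberCount (b.vertexTuple p a') j ≠ 1) :
    (Finset.univ.image (Sum.elim a a')).card ≤ Fintype.card b.Vertex * (p - 1) := by
  have hp0 : 0 < p := by omega
  set k := b.vertexTuple p a
  set k' := b.vertexTuple p a'
  set H := Finset.univ.image k ∪ Finset.univ.image k' with hH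
  have hkH : ∀ v, k v ∈ H := fun v =>
    Finset.mem_union_left _ (Finset.mem_image_of_mem _ (Finset.mem_univ _))
  have hkH' : ∀ v, k' v ∈ H := fun v =>
    Finset.mem_union_right _ (Finset.mem_image_of_mem _ (Finset.mem_univ _))
  have hcases : ∀ j ∈ H, (∃ v, k v = j) ∨ ∃ v, k' v = j := by
    intro j hj
    simpa [hH] using hj
  refine le_trans (Finset.card_le_card ?_) (card_colors_le hp
    (fun j : {i : Fin p → Fin N // Monotone i} => j.1) k k' H hkH hkH' ?_ ?_ hshared
    (b.even_sum_tupleCount hb hp0 a))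
  · intro c hc
    obtain ⟨e | e, -, rfl⟩ := Finset.mem_image.mp hc
    · induction e using Quotient.ind with
      | _ x => exact Finset.mem_biUnion.mpr ⟨_, hkH _, b.mem_image_vertexTuple hb hp0 a x⟩
    · induction e using Quotient.ind with
      | _ x => exact Finset.mem_biUnion.mpr ⟨_, hkH' _, b.mem_image_vertexTuple hb hp0 a' x⟩
  · intro S hSH hne hSne
    -- If nothing outside `S` touches `S`, then `S` absorbs every class of an assignment once it
    -- contains one. The shared class carries this over to the other assignment, so `S` is all of
    -- `H`.
    by_contra! hno
    have hS {v} := b.vertexTuple_mem_of_mem (v := v) hb hp0 hconn a S fun v hv => hno _ (hkH v) hv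
    have hS' {v} := b.vertexTuple_mem_of_mem (v := v) hb hp0 hconn a' S fun v hv => hno _ (hkH' v) hv
    obtain ⟨v₀, v₁, h01⟩ := hshared
    obtain ⟨j, hj⟩ := hne
    have hboth : (∀ w, k w ∈ S) ∧ ∀ w, k' w ∈ S := by
      rcases hcases j (hSH hj) with ⟨v, rfl⟩ | ⟨v, rfl⟩
      · have h1 := hS hj
        exact ⟨h1, hS' (v := v₁) (h01.subst (motive := (· ∈ S)) (h1 v₀))⟩
      · have h1 := hS' hj
        exact ⟨hS (v := v₀) (h01.symm.subst (motive := (· ∈ S)) (h1 v₁)), h1⟩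
    refine hSne (hSH.antisymm fun i hi => ?_)
    rcases hcases i hi with ⟨v, rfl⟩ | ⟨v, rfl⟩
    exacts [hboth.1 v, hboth.2 v]
  · intro j hj
    have h1 := hmult j
    rcases hcases j hj with ⟨v, rfl⟩ | ⟨v, rfl⟩
    · have := fiberCount_pos k v
      omega
    · have := fiberCount_pos k' v
      omega

theorem trace_eq_sum_prod [Finite Q] (hb : b.IsRegular p) (T : SymTensor p N) :
    b.trace hb T = ∑ a : b.Edge → Fin N, ∏ v, T.entry (b.vertexTuple p a v).1 := by
  simp only [trace, vertexEntry_eq]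

theorem trace_normalize [Finite Q] (hb : b.IsRegular p) (T : SymTensor p N) :
    b.trace hb T.normalize =
      (((N : ℝ) ^ (((p : ℝ) - 1) / 2)) ^ Fintype.card b.Vertex)⁻¹ * b.trace hb T := by
  simp only [trace_eq_sum_prod, Finset.mul_sum]
  refine Finset.sum_congr rfl fun a _ => ?_
  simp only [SymTensor.normalize, SymTensor.entry, Finset.prod_div_distrib, Finset.prod_const,
    Finset.card_univ]
  rw [div_eq_inv_mul]

end CombMap

/-! ### Variance of a single trace invariant -/

namespace CombMap

variable {Q : Type} (b : CombMap Q) {p : ℕ}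

theorem nonempty_edge (hconn : b.graph.Connected) : Nonempty b.Edge := by
  obtain ⟨v⟩ := hconn.nonempty
  exact ⟨b.edgeOf v.out⟩

variable [Finite Q]

theorem memLp_two_trace (hb : b.IsRegular p) (hconn : b.graph.Connected) {N : ℕ} {Ω : Type*}
    [MeasurableSpace Ω] {μ : Measure Ω} {T : Ω → SymTensor p N}
    (hT : IsWignerEntries μ T) : MemLp (fun ω => b.trace hb (T ω)) 2 μ := by
  have := hconn.nonempty
  simp only [trace_eq_sum_prod]
  exact memLp_finsetSum _ fun a _ => memLp_two_prod_of_moments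
    (X := fun (j : {i : Fin p → Fin N // Monotone i}) ω => (T ω).entry j.1)
    (fun j => hT.measurable j.1) (fun j => hT.finite_moments j.1) (b.vertexTuple p a)

/-- The variance of a trace invariant before normalization is `O(N ^ ((p - 1) |V|))`, with a
constant that depends only on the map and on bounds on the moments. -/
theorem variance_trace_le (hb : b.IsRegular p) (hp : 2 ≤ p) (hconn : b.graph.Connected)
    {B B' : ℝ} {N : ℕ} {Ω : Type*} [MeasurableSpace Ω] {μ : Measure Ω} [IsProbabilityMeasure μ]
    {T : Ω → SymTensor p N} (hT : IsWignerEntries μ T)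
    (hB : ∀ i, ∫ ω, |(T ω).entry i| ^ Fintype.card b.Vertex ∂μ ≤ B)
    (hB' : ∀ i, ∫ ω, |(T ω).entry i| ^ Fintype.card (b.Vertex ⊕ b.Vertex) ∂μ ≤ B') :
    variance (fun ω => b.trace hb (T ω)) μ ≤
      ((Fintype.card b.Vertex * (p - 1)) ^ Fintype.card (b.Edge ⊕ b.Edge) *
        N ^ (Fintype.card b.Vertex * (p - 1)) : ℕ) *
      |Fintype.card (b.Vertex ⊕ b.Vertex) * B' + (Fintype.card b.Vertex * B) ^ 2| := by
  classical
  have := hconn.nonempty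
  have := b.nonempty_edge hconn
  simp only [trace_eq_sum_prod]
  set X := fun (j : {i : Fin p → Fin N // Monotone i}) ω => (T ω).entry j.1
  have hX : ∀ j, Measurable (X j) := fun j => hT.measurable j.1
  have hint : ∀ j (k : ℕ), Integrable (fun ω => |X j ω| ^ k) μ := fun j => hT.finite_moments j.1
  set r := Fintype.card b.Vertex * (p - 1)
  -- `G` may contain uncorrelated pairs; it only has to contain all the correlated ones. A pair is
  -- counted as one function on `b.Edge ⊕ b.Edge`.
  let G : Finset ((b.Edge → Fin N) × (b.Edge → Fin N)) :=
    Finset.univ.filter fun x => (Finset.univ.image (Sum.elim x.1 x.2)).card ≤ r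
  have hcardG : G.card ≤ r ^ Fintype.card (b.Edge ⊕ b.Edge) * N ^ r := by
    have h := card_filter_card_image_le (E := b.Edge ⊕ b.Edge) (C := Fin N) r
    rw [Fintype.card_fin] at h
    refine le_trans (Finset.card_le_card_of_injOn (fun x => Sum.elim x.1 x.2) ?_ ?_) h
    · intro x hx
      simpa [G] using hx
    · intro x _ y _ hxy
      exact Prod.ext (funext fun e => congrFun hxy (Sum.inl e))
        (funext fun e => congrFun hxy (Sum.inr e))
  refine (variance_sum_le_card_mul (fun (a : b.Edge → Fin N) ω => ∏ v, X (b.vertexTuple p a v) ω)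
    (fun a => memLp_two_prod_of_moments hX hint _) (fun a a' =>
      (abs_covariance_prod_le_of_moments hX hint (fun j => hB j.1) (fun j => hB' j.1) _ _).trans
        (le_abs_self _)) G fun a a' haa' => ?_).trans
    (mul_le_mul_of_nonneg_right (Nat.cast_le.mpr hcardG) (abs_nonneg _))
  refine covariance_prod_eq_zero hT.indep hX hint (fun j => hT.centered j.1) _ _ ?_
  by_contra! hcon
  exact haa' (Finset.mem_filter.mpr ⟨Finset.mem_univ _,
    b.card_image_sumElim_le hb hp hconn a a' hcon.1 hcon.2⟩)

theorem variance_trace_normalize_isBigO (hb : b.IsRegular p) (hp : 2 ≤ p)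
    (hconn : b.graph.Connected)
    {Ω : ℕ → Type*} [∀ N, MeasurableSpace (Ω N)]
    {μ : ∀ N, Measure (Ω N)} [∀ N, IsProbabilityMeasure (μ N)]
    {T : ∀ N, Ω N → SymTensor p N} (hT : ∀ N, IsWignerEntries (μ N) (T N))
    (hmom : ∀ k : ℕ, ∃ C : ℝ, ∀ (N : ℕ) (i : Fin p → Fin N),
      ∫ ω, |(T N ω).entry i| ^ k ∂(μ N) ≤ C) :
    (fun N : ℕ => variance (fun ω => 1 / (N : ℝ) * b.trace hb (T N ω).normalize) (μ N))
      =O[atTop] (fun N : ℕ => 1 / (N : ℝ) ^ 2) := by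
  obtain ⟨B, hB⟩ := hmom (Fintype.card b.Vertex)
  obtain ⟨B', hB'⟩ := hmom (Fintype.card (b.Vertex ⊕ b.Vertex))
  set m := Fintype.card b.Vertex with hm
  set R := (m * (p - 1)) ^ Fintype.card (b.Edge ⊕ b.Edge)
  set D := |Fintype.card (b.Vertex ⊕ b.Vertex) * B' + (m * B) ^ 2|
  refine IsBigO.of_bound (R * D) ?_
  filter_upwards [eventually_gt_atTop 0] with N hN
  have hN' : (0 : ℝ) < N := Nat.cast_pos.mpr hN
  rw [Real.norm_of_nonneg (variance_nonneg _ _), Real.norm_of_nonneg (by positivity)]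
  simp only [trace_normalize, ← mul_assoc]
  rw [variance_const_mul]
  -- Squaring clears the half-integer exponent and matches the number of surviving pairs.
  have hpow : (((N : ℝ) ^ (((p : ℝ) - 1) / 2)) ^ m) ^ 2 = (N : ℝ) ^ (m * (p - 1)) := by
    rw [← pow_mul, mul_comm m 2, pow_mul, ← Real.rpow_mul_natCast hN'.le, mul_comm m, pow_mul,
      ← Real.rpow_natCast _ (p - 1), Nat.cast_sub (by omega)]
    norm_num
  have hvar := b.variance_trace_le hb hp hconn (hT N) (hB N) (hB' N)
  rw [← hm] at hvar ⊢
  calc (1 / (N : ℝ) * (((N : ℝ) ^ (((p : ℝ) - 1) / 2)) ^ m)⁻¹) ^ 2 *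
        variance (fun ω => b.trace hb (T N ω)) (μ N)
      ≤ (1 / (N : ℝ) * (((N : ℝ) ^ (((p : ℝ) - 1) / 2)) ^ m)⁻¹) ^ 2 *
        ((R * N ^ (m * (p - 1)) : ℕ) * D) := by gcongr
    _ = R * D * (1 / (N : ℝ) ^ 2) := by
      rw [mul_pow, inv_pow, hpow]
      push_cast
      field_simp

end CombMap

/-! ### Summation over the maps -/

theorem memLp_and_variance_sum_isBigO {ι : Type*} (s : Finset ι)
    {Ω : ℕ → Type*} [∀ N, MeasurableSpace (Ω N)]
    {μ : ∀ N, Measure (Ω N)} [∀ N, IsProbabilityMeasure (μ N)]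
    (X : ι → ∀ N, Ω N → ℝ) (g : ℕ → ℝ) (hX : ∀ i N, MemLp (X i N) 2 (μ N))
    (hvar : ∀ i, (fun N => variance (X i N) (μ N)) =O[atTop] g) :
    (∀ N, MemLp (fun ω => ∑ i ∈ s, X i N ω) 2 (μ N)) ∧
      (fun N => variance (fun ω => ∑ i ∈ s, X i N ω) (μ N)) =O[atTop] g := by
  classical
  have hmem : ∀ (s : Finset ι) N, MemLp (fun ω => ∑ i ∈ s, X i N ω) 2 (μ N) := fun s N =>
    memLp_finsetSum _ fun i _ => hX i N
  refine ⟨hmem s, ?_⟩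
  induction s using Finset.induction_on with
  | empty =>
    have h0 : ∀ N, variance (fun _ : Ω N => (0 : ℝ)) (μ N) = 0 := fun N => variance_zero _
    simp only [Finset.sum_empty, h0]
    exact isBigO_zero _ _
  | insert i s his ih =>
    simp only [Finset.sum_insert his]
    refine IsBigO.trans (IsBigO.of_norm_le fun N => ?_)
      (((hvar i).const_mul_left 2).add (ih.const_mul_left 2))
    rw [Real.norm_of_nonneg (variance_nonneg _ _)]
    exact variance_add_le_two_mul (hX i N) (hmem s N)

theorem theorem2 (p : ℕ) (hp : 2 ≤ p)
    (Ω : ℕ → Type*) [∀ N, MeasurableSpace (Ω N)]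
    (μ : ∀ N, Measure (Ω N)) [∀ N, IsProbabilityMeasure (μ N)]
    (T : ∀ N, Ω N → SymTensor p N)
    (hT : ∀ N, IsWignerEntries (μ N) (T N))
    (hmom : ∀ k : ℕ, ∃ C : ℝ, ∀ (N : ℕ) (i : Fin p → Fin N), ∫ ω, |(T N ω).entry i| ^ k ∂(μ N) ≤ C)
    (n : ℕ) :
    (∀ N : ℕ, MemLp (fun ω => 1 / (N : ℝ) * balancedTrace n (T N ω).normalize) 2 (μ N)) ∧
    (fun N : ℕ => variance (fun ω => 1 / (N : ℝ) * balancedTrace n (T N ω).normalize) (μ N))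
      =O[atTop] (fun N : ℕ => 1 / (N : ℝ) ^ 2) := by
  by_cases hn : n = 0
  · simp only [balancedTrace, if_pos hn]
    refine ⟨fun N => memLp_const _, ?_⟩
    -- The variable is deterministic, also at `N = 0`, where its value is 0 instead of 1.
    have h0 : ∀ N : ℕ, variance (fun _ : Ω N => 1 / (N : ℝ) * (N : ℝ)) (μ N) = 0 := fun N => by
      rw [← covariance_self aemeasurable_const, covariance_const_left]
    simp only [h0]
    exact isBigO_zero _ _
  · simp only [balancedTrace, if_neg hn, Finset.mul_sum]
    refine memLp_and_variance_sum_isBigO Finset.univ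
      (fun (b : UnlabelledRootedMap p n) N ω => 1 / (N : ℝ) * b.trace (T N ω).normalize) _
      (fun b N => ?_) fun b => ?_
    · induction b using Quotient.ind with
      | _ b =>
        change MemLp (fun ω => 1 / (N : ℝ) * b.toCombMap.trace b.regular (T N ω).normalize) 2 (μ N)
        simp only [CombMap.trace_normalize]
        exact ((b.toCombMap.memLp_two_trace b.regular b.connected (hT N)).const_mul _).const_mul _
    · induction b using Quotient.ind with
      | _ b => exact b.toCombMap.variance_trace_normalize_isBigO b.regular hp b.connected hT hmom
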